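/- \textbf{Notation.} Let $\mathbb{K}=\mathbb{R}$ or $\mathbb{C}$, let $\Omega,\omega$ be non-empty sets, and let $E$ be a non-trivial locally convex Hausdorff space over $\mathbb{K}$. Continuous duals are denoted by $'$. Let $\mathcal{F}(\Omega)\subset\mathbb{K}^{\Omega}$ and $\mathcal{F}(\Omega,E)\subset E^{\Omega}$ be linear subspaces, each equipped with a locally convex Hausdorff topology, such that the point evaluations $\delta_x$, $x\in\Omega$, belong to $\mathcal{F}(\Omega)'$. Let $\mathcal{F}(\Omega)\varepsilon E$ be the space of continuous linear maps $u\colon\mathcal{F}(\Omega)'_{\kappa}\to E$, where $\kappa$ is the topology of uniform convergence on the absolutely convex compact subsets of $\mathcal{F}(\Omega)$, equipped with the topology of uniform convergence on the equicontinuous subsets of $\mathcal{F}(\Omega)'$. For $u\in\mathcal{F}(\Omega)\varepsilon E$ let $S(u)\colon\Omega\to E$, $S(u)(x):=u(\delta_x)$. \textbf{Assumptions.} \begin{enumerate} \item $E$ is locally complete: for every closed, bounded, absolutely convex set $D\subset E$ the space $E_D=\bigcup_{n\in\mathbb{N}}nD$, normed by the gauge of $D$, is complete. \item $G\subset E'$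 is a linear subspace which determines boundedness: every $\sigma(E,G)$-bounded subset of $E$ is bounded in $E$. \item $\mathcal{F}(\Omega)$ and $\mathcal{F}(\Omega,E)$ are $\varepsilon$-into-compatible: $S$ maps $\mathcal{F}(\Omega)\varepsilon E$ into $\mathcal{F}(\Omega,E)$ and is a topological isomorphism onto its range. \item $T^{\mathbb{K}}\colon\mathcal{F}(\Omega)\to\mathbb{K}^{\omega}$ and $T^{E}\colon\mathcal{F}(\Omega,E)\to E^{\omega}$ are linear maps such that $(T^E,T^{\mathbb{K}})$ is \emph{consistent}: $T^{\mathbb{K}}_x:=\delta_x\circ T^{\mathbb{K}}\in\mathcal{F}(\Omega)'$ and $T^E(S(u))(x)=u(T^{\mathbb{K}}_x)$ for all $u\in\mathcal{F}(\Omega)\varepsilon E$, $x\in\omega$; and \emph{strong}: $e'\circ f\in\mathcal{F}(\Omega)$ and $T^{\mathbb{K}}(e'\circ f)(x)=e'(T^E(f)(x))$ for all $e'\in E'$, $f\in\mathcal{F}(\Omega,E)$, $x\in\omega$. \item $\nu\colon\omega\to(0,\infty)$, and $\mathcal{F}\nu(\Omega):=\{f\in\mathcal{F}(\Omega) : |f|:=\sup_{x\in\omega}|T^{\mathbb{K}}(f)(x)|\,\nu(x)<\infty\}$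 is a Banach space with respect to $|\cdot|$, whose closed unit ball $B$ is a compact subset of $\mathcal{F}(\Omega)$. \item $U\subset\omega$ is a set of uniqueness: if $f\in\mathcal{F}\nu(\Omega)$ and $T^{\mathbb{K}}(f)(x)=0$ for all $x\in U$, then $f=0$. \end{enumerate} Put $B^{\circ}:=\{y'\in\mathcal{F}(\Omega)' : |y'(f)|\le 1 \text{ for all } f\in B\}$ and $$\mathcal{F}_{\varepsilon}\nu(\Omega,E):=S\bigl(\{u\in\mathcal{F}(\Omega)\varepsilon E : u(B^{\circ})\text{ is bounded in }E\}\bigr),$$ and let $\mathcal{F}\nu_G(U,E)$ be the space of all functions $f\colon U\to E$ such that for every $e'\in G$ there is $f_{e'}\in\mathcal{F}\nu(\Omega)$ with $T^{\mathbb{K}}(f_{e'})(x)=e'(f(x))$ for all $x\in U$. \textbf{Theorem.} Under these assumptions the restriction map $$R_{U,G}\colon\mathcal{F}_{\varepsilon}\nu(\Omega,E)\to\mathcal{F}\nu_G(U,E),\qquad f\mapsto\bigl(T^E(f)(x)\bigr)_{x\in U},$$ is well-defined and surjective. -/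

import Mathlib

open Set Filter Topology
open scoped NNReal Pointwise

noncomputable section

/-! ### Locally convex Hausdorff spaces of functions -/

/-- A locally convex Hausdorff space of functions `Ω → X` over `𝕜`: a linear subspace of `X^Ω`
together with a locally convex Hausdorff vector space topology of its own (in general not the one
induced by pointwise convergence). -/
structure FunctionSpace (𝕜 : Type*) [RCLike 𝕜] (Ω X : Type*) [AddCommGroup X] [Module 𝕜 X]
    [Module ℝ X] [IsScalarTower ℝ 𝕜 X] where
  /-- The underlying linear space of functions. -/
  carrier : Submodule 𝕜 (Ω → X)
  /-- The topology. -/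
  topology : TopologicalSpace carrier
  isTopologicalAddGroup : @IsTopologicalAddGroup carrier topology _
  continuousSMul : @ContinuousSMul 𝕜 carrier _ _ topology
  locallyConvexSpace : @LocallyConvexSpace ℝ carrier _ _ _ _ topology
  t2Space : @T2Space carrier topology

namespace FunctionSpace

section Basic

variable {𝕜 : Type*} [RCLike 𝕜] {Ω X : Type*} [AddCommGroup X] [Module 𝕜 X]
  [Module ℝ X] [IsScalarTower ℝ 𝕜 X]

/-- The type of elements of the function space `F`, carrying the topology of `F`. -/
def Space (F : FunctionSpace 𝕜 Ω X) : Type _ := F.carrier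

variable (F : FunctionSpace 𝕜 Ω X)

instance : AddCommGroup F.Space := inferInstanceAs (AddCommGroup F.carrier)
instance : Module 𝕜 F.Space := inferInstanceAs (Module 𝕜 F.carrier)
instance : Module ℝ F.Space := inferInstanceAs (Module ℝ F.carrier)
instance : IsScalarTower ℝ 𝕜 F.Space := inferInstanceAs (IsScalarTower ℝ 𝕜 F.carrier)
instance : TopologicalSpace F.Space := F.topology
instance : IsTopologicalAddGroup F.Space := F.isTopologicalAddGroup
instance : ContinuousSMul 𝕜 F.Space := F.continuousSMul
instance : LocallyConvexSpace ℝ F.Space := F.locallyConvexSpace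
instance : T2Space F.Space := F.t2Space

/-- The inclusion `F ⊆ X^Ω`. -/
def toFun : F.Space →ₗ[𝕜] (Ω → X) := F.carrier.subtype

/-- A function belonging to `F`, as an element of `F`. -/
def ofMem (f : Ω → X) (hf : f ∈ F.carrier) : F.Space := ⟨f, hf⟩

end Basic

end FunctionSpace

/-! ### The `ε`-product -/

section EpsProduct

variable (𝕜 : Type*) [RCLike 𝕜]
  (Y : Type*) [AddCommGroup Y] [Module 𝕜 Y] [Module ℝ Y] [TopologicalSpace Y]
  (E : Type*) [AddCommGroup E] [Module 𝕜 E] [TopologicalSpace E] [IsTopologicalAddGroup E]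

/-- `Y'_κ`: the continuous dual of `Y` with the topology of uniform convergence on the
absolutely convex compact subsets of `Y`. -/
abbrev KappaDual : Type _ :=
  UniformConvergenceCLM (RingHom.id 𝕜) (E := Y) 𝕜 {K | Balanced 𝕜 K ∧ Convex ℝ K ∧ IsCompact K}

/-- A continuous linear functional, as an element of `Y'_κ`. -/
def KappaDual.of (y' : Y →L[𝕜] 𝕜) : KappaDual 𝕜 Y :=
  UniformConvergenceCLM.ofFun (RingHom.id 𝕜) 𝕜 _ y'

/-- Schwartz' `ε`-product `Y ε E = L_e(Y'_κ, E)`: the continuous linear operators `Y'_κ → E` with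
the topology of uniform convergence on the equicontinuous subsets of `Y'`. -/
abbrev EpsProduct : Type _ :=
  UniformConvergenceCLM (RingHom.id 𝕜) (E := KappaDual 𝕜 Y) E
    {H | Equicontinuous fun (y' : H) (y : Y) => (y' : KappaDual 𝕜 Y) y}

end EpsProduct

/-! ### Compatibility, consistency and strength -/

section Families

variable {𝕜 : Type*} [RCLike 𝕜] {Ω ω : Type*}
  {E : Type*} [AddCommGroup E] [Module 𝕜 E] [Module ℝ E] [IsScalarTower ℝ 𝕜 E]
  [TopologicalSpace E] [IsTopologicalAddGroup E]

/-- `T_x = δ_x ∘ T`, as an element of `F'_κ`, for a linear map `T : F → 𝕜^ω` such that `T_x` is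
continuous. -/
def evalAt {F : FunctionSpace 𝕜 Ω 𝕜} (T : F.Space →ₗ[𝕜] (ω → 𝕜))
    (hT : ∀ x, Continuous fun f => T f x) (x : ω) : KappaDual 𝕜 F.Space :=
  KappaDual.of 𝕜 F.Space ⟨(LinearMap.proj x).comp T, hT x⟩

/-- The map `S : F ε E → E^Ω`, `S(u)(x) = u(δ_x)`, given that all `δ_x` are continuous on `F`. -/
def mapS {F : FunctionSpace 𝕜 Ω 𝕜} (hδ : ∀ x, Continuous fun f => F.toFun f x)
    (u : EpsProduct 𝕜 F.Space E) : Ω → E :=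
  fun x => u (evalAt F.toFun hδ x)

variable (F : FunctionSpace 𝕜 Ω 𝕜) (FE : FunctionSpace 𝕜 Ω E)

/-- `F` and `FE` are `ε`-into-compatible: all `δ_x` belong to `F'` and `S : F ε E → FE` is a
well-defined (topological) isomorphism onto its range. -/
structure EpsIntoCompatible : Prop where
  continuous_eval : ∀ x, Continuous fun f => F.toFun f x
  mapS_mem : ∀ u : EpsProduct 𝕜 F.Space E, mapS continuous_eval u ∈ FE.carrier
  isEmbedding : IsEmbedding fun u : EpsProduct 𝕜 F.Space E =>
    FE.ofMem (mapS continuous_eval u) (mapS_mem u)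

variable {F FE}

/-- `(T^E, T^𝕜)` is a consistent family: `T^𝕜_x ∈ F'`, `S(u) ∈ FE` and
`T^E(S(u))(x) = u(T^𝕜_x)` for all `u ∈ F ε E` and `x ∈ ω`. -/
structure IsConsistent (hδ : ∀ x, Continuous fun f => F.toFun f x)
    (TE : FE.Space →ₗ[𝕜] (ω → E)) (TK : F.Space →ₗ[𝕜] (ω → 𝕜)) : Prop where
  continuous_apply : ∀ x, Continuous fun f => TK f x
  mapS_mem : ∀ u : EpsProduct 𝕜 F.Space E, mapS hδ u ∈ FE.carrier
  apply_mapS : ∀ (u : EpsProduct 𝕜 F.Space E) (x : ω),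
    TE (FE.ofMem (mapS hδ u) (mapS_mem u)) x = u (evalAt TK continuous_apply x)

/-- `(T^E, T^𝕜)` is a strong family: `e' ∘ f ∈ F` and `T^𝕜(e' ∘ f) = e' ∘ T^E(f)` for all
`e' ∈ E'` and `f ∈ FE`. -/
def IsStrong (TE : FE.Space →ₗ[𝕜] (ω → E)) (TK : F.Space →ₗ[𝕜] (ω → 𝕜)) : Prop :=
  ∀ (e' : E →L[𝕜] 𝕜) (f : FE.Space),
    ∃ h : (fun y => e' (FE.toFun f y)) ∈ F.carrier, ∀ x : ω, TK (F.ofMem _ h) x = e' (TE f x)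

end Families

/-! ### The weighted space `Fν(Ω)` -/

section Weighted

variable {𝕜 : Type*} [RCLike 𝕜] {Ω ω : Type*} {F : FunctionSpace 𝕜 Ω 𝕜}
  (TK : F.Space →ₗ[𝕜] (ω → 𝕜)) (ν : ω → ℝ≥0)

/-- `Fν(Ω) = {f ∈ F | sup_x |T^𝕜(f)(x)| ν(x) < ∞}` as a linear subspace of `F`. -/
def weightedSubmodule : Submodule 𝕜 F.Space where
  carrier := {f | BddAbove (range fun x => ‖TK f x‖ * (ν x : ℝ))}
  zero_mem' := ⟨0, by rintro _ ⟨x, rfl⟩; simp⟩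
  add_mem' := by
    rintro f g ⟨a, ha⟩ ⟨b, hb⟩
    refine ⟨a + b, ?_⟩
    rintro _ ⟨x, rfl⟩
    have h1 := ha ⟨x, rfl⟩
    have h2 := hb ⟨x, rfl⟩
    have h3 := mul_le_mul_of_nonneg_right (norm_add_le (TK f x) (TK g x)) (ν x).2
    simp only [map_add, Pi.add_apply] at *
    exact h3.trans (by rw [add_mul]; exact add_le_add h1 h2)
  smul_mem' := by
    rintro c f ⟨a, ha⟩
    refine ⟨‖c‖ * a, ?_⟩
    rintro _ ⟨x, rfl⟩
    have h1 := mul_le_mul_of_nonneg_left (ha ⟨x, rfl⟩) (norm_nonneg c)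
    simpa [mul_assoc] using h1

/-- The space `Fν(Ω)`, carrying the topology of the seminorm `sup_x |T^𝕜(f)(x)| ν(x)`. -/
def WeightedSpace : Type _ := weightedSubmodule TK ν

instance : AddCommGroup (WeightedSpace TK ν) :=
  inferInstanceAs (AddCommGroup (weightedSubmodule TK ν))
instance : Module 𝕜 (WeightedSpace TK ν) :=
  inferInstanceAs (Module 𝕜 (weightedSubmodule TK ν))

/-- The inclusion `Fν(Ω) ⊆ F`. -/
def WeightedSpace.incl : WeightedSpace TK ν →ₗ[𝕜] F.Space := (weightedSubmodule TK ν).subtype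

/-- The seminorm `|f| = sup_x |T^𝕜(f)(x)| ν(x)` on `Fν(Ω)`. -/
def weightedSeminorm : Seminorm 𝕜 (WeightedSpace TK ν) :=
  Seminorm.of (fun f => ⨆ x, ‖TK (WeightedSpace.incl TK ν f) x‖ * (ν x : ℝ))
    (by
      intro f g
      refine Real.iSup_le (fun x => ?_) (add_nonneg
        (Real.iSup_nonneg fun x => by positivity) (Real.iSup_nonneg fun x => by positivity))
      refine le_trans ?_ (add_le_add (le_ciSup f.2 x) (le_ciSup g.2 x))
      rw [map_add (WeightedSpace.incl TK ν), map_add TK]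
      exact (mul_le_mul_of_nonneg_right (norm_add_le _ _) (ν x).2).trans_eq (add_mul _ _ _))
    (by
      intro c f
      rw [Real.mul_iSup_of_nonneg (norm_nonneg c)]
      simp [mul_assoc])

instance : SeminormedAddCommGroup (WeightedSpace TK ν) :=
  (weightedSeminorm TK ν).toAddGroupSeminorm.toSeminormedAddCommGroup
instance : NormedSpace 𝕜 (WeightedSpace TK ν) where
  norm_smul_le c f := ((weightedSeminorm TK ν).smul' c f).le

/-- `Fν(Ω)` is a Banach space: its seminorm is a norm and it is complete. -/
def WeightedSpace.IsBanach : Prop :=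
  (∀ f : WeightedSpace TK ν, ‖f‖ = 0 → f = 0) ∧ CompleteSpace (WeightedSpace TK ν)

/-- The closed unit ball of `Fν(Ω)`, as a subset of `F`. -/
def WeightedSpace.unitBall : Set F.Space :=
  WeightedSpace.incl TK ν '' Metric.closedBall 0 1

/-- The polar in `F'` of the closed unit ball of `Fν(Ω)`. -/
def WeightedSpace.unitBallPolar : Set (KappaDual 𝕜 F.Space) :=
  {y' | ∀ f ∈ WeightedSpace.unitBall TK ν, ‖y' f‖ ≤ 1}

/-- `U ⊆ ω` is a set of uniqueness for `(T^𝕜, Fν)`. -/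
def IsUniquenessSet (U : Set ω) : Prop :=
  ∀ f : WeightedSpace TK ν, (∀ x ∈ U, TK (WeightedSpace.incl TK ν f) x = 0) → f = 0

variable {E : Type*} [AddCommGroup E] [Module 𝕜 E] [TopologicalSpace E]

/-- The restriction space `Fν_G(U,E)`: all `f : U → E` such that for every `e' ∈ G` there is
`f_{e'} ∈ Fν(Ω)` with `T^𝕜(f_{e'})(x) = e'(f(x))` for all `x ∈ U`. -/
def restrictionSpace (G : Submodule 𝕜 (E →L[𝕜] 𝕜)) (U : Set ω) : Set (U → E) :=
  {f | ∀ e' ∈ G, ∃ g : WeightedSpace TK ν,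
    ∀ x : U, TK (WeightedSpace.incl TK ν g) x = e' (f x)}

variable [Module ℝ E] [IsScalarTower ℝ 𝕜 E] [IsTopologicalAddGroup E]
  {FE : FunctionSpace 𝕜 Ω E}

/-- The space `F_εν(Ω,E) = S({u ∈ F ε E | u(B°) is bounded in E})`, where `B°` is the polar in `F'`
of the closed unit ball `B` of `Fν(Ω)`. -/
def mingleMangle (hS : EpsIntoCompatible F FE) : Set FE.Space :=
  (fun u : EpsProduct 𝕜 F.Space E => FE.ofMem (mapS hS.continuous_eval u) (hS.mapS_mem u)) ''
    {u | Bornology.IsVonNBounded 𝕜 (u '' WeightedSpace.unitBallPolar TK ν)}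

/-- The restriction map `f ↦ (T^E(f)(x))_{x ∈ U}`. -/
def restrictionMap (TE : FE.Space →ₗ[𝕜] (ω → E)) (U : Set ω) (f : FE.Space) : U → E :=
  fun x => TE f x

end Weighted

/-! ### Local completeness and subspaces determining boundedness -/

section LocallyConvex

variable (𝕜 : Type*) [RCLike 𝕜] {E : Type*} [AddCommGroup E] [Module 𝕜 E]
  [TopologicalSpace E]

/-- `E` is locally complete: for every closed disk `D` (closed, bounded, absolutely convex set) the
space `E_D = ⋃ n, n D`, normed by the gauge of `D`, is complete. -/
def IsLocallyComplete (E : Type*) [AddCommGroup E] [Module 𝕜 E] [Module ℝ E]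
    [TopologicalSpace E] : Prop :=
  ∀ D : Set E, IsClosed D → Bornology.IsVonNBounded 𝕜 D → Balanced 𝕜 D → Convex ℝ D →
    ∀ x : ℕ → E, (∀ k, x k ∈ ⋃ n : ℕ, (n : ℝ) • D) →
      (∀ r > 0, ∃ N, ∀ k ≥ N, ∀ l ≥ N, gauge D (x k - x l) < r) →
      ∃ y ∈ ⋃ n : ℕ, (n : ℝ) • D, Tendsto (fun k => gauge D (x k - y)) atTop (𝓝 0)

variable {𝕜}

/-- The canonical pairing `E × G → 𝕜` for a subspace `G` of `E'`. -/
def dualPairing (G : Submodule 𝕜 (E →L[𝕜] 𝕜)) : E →ₗ[𝕜] G →ₗ[𝕜] 𝕜 :=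
  ((ContinuousLinearMap.coeLM 𝕜).comp G.subtype).flip

/-- `G ⊆ E'` determines boundedness: every `σ(E,G)`-bounded subset of `E` is bounded in `E`. -/
def DeterminesBoundedness (G : Submodule 𝕜 (E →L[𝕜] 𝕜)) : Prop :=
  ∀ B : Set E, Bornology.IsVonNBounded 𝕜 (E := WeakBilin (dualPairing G)) B →
    Bornology.IsVonNBounded 𝕜 B

end LocallyConvex

end

open Set Filter Topology
open scoped NNReal Pointwise

/-! Let p(y') be the norm of y' restricted to Fν(Ω), so that B° = {p ≤ 1}. Given f in Fν_G(U,E), one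
seeks u with u(T_x) = f(x) for x ∈ U. For a finite combination y = Σ c_x T_x and e' ∈ G one has e'(Σ
c_x f(x)) = y(f_{e'}), of modulus at most p(y)|f_{e'}|. As G determines boundedness, the
combinations with p ≤ 1 go to a bounded set, whose closure D is a closed disk. Compactness of B and
uniqueness on U make these combinations p-dense in F(Ω)' (`exists_linearCombination_norm_sub_le`).
Completeness of E_D then extends the map to all of F(Ω)', with u(B°) ⊆ 3D
(`exists_linearMap_extension`). Since B° is a κ-neighbourhood of 0 (`unitBallPolar_mem_nhds_zero`),
u is continuous, and S(u) restricts to f by consistency. Well-definedness rests on ν(x)T_x ∈ B°. -/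

/-! ### Density of separating functionals over a compact unit ball. -/

theorem ContinuousLinearMap.opNorm_le_of_closedBall {𝕜 V : Type*} [RCLike 𝕜]
    [SeminormedAddCommGroup V] [NormedSpace 𝕜 V] (f : V →L[𝕜] 𝕜) {C : ℝ}
    (h : ∀ v, ‖v‖ ≤ 1 → ‖f v‖ ≤ C) : ‖f‖ ≤ C := by
  refine f.opNorm_le_bound ((norm_nonneg _).trans (h 0 (by simp))) fun v => ?_
  rcases (norm_nonneg v).eq_or_lt with hv | hv
  · simpa [← hv] using f.le_opNorm v
  · have := h (((‖v‖⁻¹ : ℝ) : 𝕜) • v) (by simp [norm_smul, hv.ne'])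
    rwa [map_smul, norm_smul, RCLike.norm_of_nonneg (by positivity), inv_mul_le_iff₀ hv,
      mul_comm] at this

/-- If the unit ball of `W` is compact for a coarser topology, then a family of functionals that
are continuous for the coarser topology and separate the points of `W` spans a norm dense subspace
of all such functionals. -/
theorem exists_linearCombination_norm_sub_le {𝕜 W Y ι : Type*} [RCLike 𝕜]
    [SeminormedAddCommGroup W] [NormedSpace 𝕜 W]
    [AddCommGroup Y] [Module 𝕜 Y] [TopologicalSpace Y]
    (j : W →L[𝕜] Y) (hj : IsCompact (j '' Metric.closedBall 0 1)) (t : ι → Y →L[𝕜] 𝕜)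
    (ht : ∀ w, (∀ i, t i (j w) = 0) → w = 0) (y : Y →L[𝕜] 𝕜) {ε : ℝ} (hε : 0 < ε) :
    ∃ c : ι →₀ 𝕜, ‖(y - Finsupp.linearCombination 𝕜 t c).comp j‖ ≤ ε := by
  classical
  have hK : IsCompact (j '' Metric.closedBall 0 1 ∩ {b | ε ≤ ‖y b‖}) :=
    hj.inter_right (isClosed_le continuous_const y.continuous.norm)
  obtain ⟨s, hs⟩ := hK.elim_finite_subfamily_closed (fun i => {b | t i b = 0})
    (fun i => isClosed_eq (t i).continuous continuous_const) (by
      -- A common zero of all `t i` is 0, where `y` vanishes; so by compactness finitely many `t i`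
      -- already have no common zero in the ball with `‖y‖ ≥ ε`.
      rw [eq_empty_iff_forall_notMem]
      rintro _ ⟨⟨⟨w, -, rfl⟩, hw⟩, hw'⟩
      rw [ht w (by simpa using hw')] at hw
      simp at hw
      linarith)
  let N : Submodule 𝕜 W := ⨅ i : s, LinearMap.ker ((t i).comp j).toLinearMap
  have hN : ∀ w ∈ N, ∀ i ∈ s, t i (j w) = 0 := by
    intro w hw i hi
    simpa using (Submodule.mem_iInf _).1 hw ⟨i, hi⟩
  -- Hahn–Banach: `y` is at most `ε` on the unit ball of `N`, and `g` keeps this bound on all of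
  -- `W`. The error `y.comp j - g` vanishes on `N`, hence is a combination of the finitely many `t
  -- i`.
  obtain ⟨g, hg, hgn⟩ := exists_extension_norm_eq N ((y.comp j).comp N.subtypeL)
  have hle : ‖(y.comp j).comp N.subtypeL‖ ≤ ε := by
    refine ContinuousLinearMap.opNorm_le_of_closedBall _ fun v hv => ?_
    by_contra hlt
    have : j v ∈ (∅ : Set Y) := by
      rw [← hs]
      refine ⟨⟨⟨v, by simpa using hv, rfl⟩, (not_le.1 hlt).le⟩, ?_⟩
      simpa using hN v v.2
    exact this
  have hspan : (y.comp j - g).toLinearMap ∈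
      Submodule.span 𝕜 (range fun i : s => ((t i).comp j).toLinearMap) := by
    refine mem_span_of_iInf_ker_le_ker fun w hw => ?_
    have := hg ⟨w, hw⟩
    simp at this
    simp [this]
  obtain ⟨c, hc⟩ := (Submodule.mem_span_range_iff_exists_fun 𝕜).1 hspan
  refine ⟨∑ i : s, Finsupp.single (i : ι) (c i), ?_⟩
  refine le_of_eq_of_le (congrArg norm ?_) (hgn.le.trans hle)
  refine ContinuousLinearMap.ext fun v => ?_
  have := congrArg (fun l : W →ₗ[𝕜] 𝕜 => l v) hc
  simp [LinearMap.sum_apply] at this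
  simp [map_sum, this]

/-! ### Disks, gauges and weak boundedness. -/

theorem Balanced.smul_mem_norm_smul {𝕜 E : Type*} [RCLike 𝕜] [AddCommGroup E] [Module 𝕜 E]
    [Module ℝ E] [IsScalarTower ℝ 𝕜 E] {D : Set E} (hb : Balanced 𝕜 D) (hne : D.Nonempty)
    {e : E} {r : ℝ} (he : e ∈ r • D) (a : 𝕜) : a • e ∈ (‖a‖ * r) • D := by
  obtain ⟨d, hd, rfl⟩ := he
  by_cases ha : a = 0
  · subst ha
    simp [zero_smul_set hne]
  · have hna : (‖a‖ : 𝕜) ≠ 0 := by simpa using ha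
    refine ⟨((‖a‖ : 𝕜)⁻¹ * a) • d, hb.smul_mem (by simp [ha]) hd, ?_⟩
    simp only [RCLike.real_smul_eq_coe_smul (K := 𝕜), smul_smul]
    congr 1
    push_cast
    field_simp

/-- Outside `⋃ n, n • D` the gauge is the infimum of the empty set, that is 0, so a small gauge says
nothing there; hence the hypothesis `he`. -/
theorem mem_smul_of_gauge_lt {E : Type*} [AddCommGroup E] [Module ℝ E] {D : Set E}
    (hc : Convex ℝ D) (h0 : (0 : E) ∈ D) {e : E}
    (he : e ∈ ⋃ n : ℕ, (n : ℝ) • D) {ε : ℝ} (h : gauge D e < ε) : e ∈ ε • D := by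
  obtain ⟨n, hn⟩ := mem_iUnion.1 he
  have hmono : ∀ {r s : ℝ}, 0 ≤ r → r ≤ s → r • D ⊆ s • D := fun {r s} hr hrs => by
    have := hc.add_smul hr (sub_nonneg.2 hrs)
    rw [add_sub_cancel] at this
    rw [this]
    exact fun x hx => ⟨x, hx, 0, ⟨0, h0, smul_zero _⟩, add_zero _⟩
  obtain ⟨b, ⟨hb, hx⟩, hba⟩ := exists_lt_of_csInf_lt
    (s := {r : ℝ | 0 < r ∧ e ∈ r • D})
    -- The gauge admits only positive radii and `n` may be 0, hence `n + 1`.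
    ⟨(n : ℝ) + 1, by positivity, hmono (by positivity) (by linarith) hn⟩ h
  exact hmono hb.le hba.le hx

theorem isVonNBounded_of_forall_mem_exists_bound {𝕜 E : Type*} [RCLike 𝕜] [AddCommGroup E]
    [Module 𝕜 E] [TopologicalSpace E] {G : Submodule 𝕜 (E →L[𝕜] 𝕜)}
    (hG : DeterminesBoundedness G) {B : Set E} (h : ∀ e' ∈ G, ∃ C, ∀ b ∈ B, ‖e' b‖ ≤ C) :
    Bornology.IsVonNBounded 𝕜 B := by
  refine hG B ?_
  have hs := LinearMap.weakBilin_withSeminorms (𝕜 := 𝕜) (E := E) (F := G) (dualPairing G)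
  refine hs.isVonNBounded_iff_seminorm_bddAbove.2 fun e' => ?_
  obtain ⟨C, hC⟩ := h e' e'.2
  exact ⟨C, forall_mem_image.2 hC⟩

/-! ### Extension of linear maps into locally complete spaces. -/

section LocallyComplete

variable {𝕜 : Type*} [RCLike 𝕜] {E : Type*} [AddCommGroup E] [Module 𝕜 E] [Module ℝ E]
  [IsScalarTower ℝ 𝕜 E] [TopologicalSpace E]

theorem eq_zero_of_forall_mem_smul [IsTopologicalAddGroup E] [T2Space E] {D : Set E}
    (hD : Bornology.IsVonNBounded 𝕜 D) {e : E} (he : ∀ ε : ℝ, 0 < ε → e ∈ ε • D) : e = 0 := by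
  have h : ∀ n : ℕ, ∃ d ∈ D, ((1 / ((n : ℝ) + 1) : ℝ) : 𝕜) • d = e := fun n => by
    obtain ⟨d, hd, h⟩ := he (1 / (n + 1)) Nat.one_div_pos_of_nat
    exact ⟨d, hd, by rw [← h]; exact (RCLike.real_smul_eq_coe_smul _ _).symm⟩
  choose d hd h using h
  have hlim : Tendsto (fun n : ℕ => ((1 / ((n : ℝ) + 1) : ℝ) : 𝕜)) atTop (𝓝 0) := by
    have := (RCLike.continuous_ofReal (K := 𝕜)).tendsto 0 |>.comp
      tendsto_one_div_add_atTop_nhds_zero_nat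
    rwa [RCLike.ofReal_zero] at this
  have := hD.smul_tendsto_zero (Eventually.of_forall hd) hlim
  refine tendsto_nhds_unique (f := fun _ : ℕ => e) tendsto_const_nhds (this.congr h)

/-- A linear map defined on a dense subspace of a seminormed space which maps the unit ball into a
closed disk `D` of a locally complete space extends to the whole space. -/
theorem exists_linearMap_extension [IsTopologicalAddGroup E] [T2Space E]
    (hE : IsLocallyComplete 𝕜 E) {D : Set E} (hcl : IsClosed D) (hbd : Bornology.IsVonNBounded 𝕜 D)
    (hb : Balanced 𝕜 D) (hc : Convex ℝ D) {P M : Type*} [AddCommGroup P] [Module 𝕜 P]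
    [AddCommGroup M] [Module 𝕜 M] (p : Seminorm 𝕜 P) (L : M →ₗ[𝕜] P) (A : M →ₗ[𝕜] E)
    (hL : ∀ y, ∀ ε : ℝ, 0 < ε → ∃ c, p (y - L c) ≤ ε) (hLA : ∀ c, p (L c) ≤ 1 → A c ∈ D) :
    ∃ u : P →ₗ[𝕜] E, (∀ c, u (L c) = A c) ∧ ∀ y, p y ≤ 1 → u y ∈ (3 : ℝ) • D := by
  have h0 : (0 : E) ∈ D := by simpa using hLA 0 (by simp)
  have hne : D.Nonempty := ⟨0, h0⟩
  have hadd : ∀ {r s : ℝ} {d e : E}, 0 ≤ r → 0 ≤ s → d ∈ r • D → e ∈ s • D →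
      d + e ∈ (r + s) • D := fun hr hs hd he => by
    rw [hc.add_smul hr hs]
    exact add_mem_add hd he
  have hneg : ∀ {r : ℝ} {d : E}, d ∈ r • D → -d ∈ r • D := fun hd => by
    simpa using hb.smul_mem_norm_smul hne hd (-1 : 𝕜)
  have hmono : ∀ {r s : ℝ} {d : E}, 0 ≤ r → r ≤ s → d ∈ r • D → d ∈ s • D :=
    fun {r s d} hr hrs hd => by
      simpa using hadd hr (sub_nonneg.2 hrs) hd ⟨0, h0, smul_zero _⟩
  have hA : ∀ c, ∀ r : ℝ, 0 < r → p (L c) ≤ r → A c ∈ r • D := by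
    intro c r hr hcr
    have h1 : A ((r : 𝕜)⁻¹ • c) ∈ D := hLA _ (by
      rw [map_smul, map_smul_eq_mul, norm_inv, RCLike.norm_of_nonneg hr.le, inv_mul_le_iff₀ hr]
      simpa using hcr)
    refine ⟨_, h1, ?_⟩
    have hr' : (r : 𝕜) ≠ 0 := by simpa using hr.ne'
    simp only [RCLike.real_smul_eq_coe_smul (K := 𝕜), map_smul, smul_smul]
    rw [mul_inv_cancel₀ hr', one_smul]
  -- The value at `y` is characterised by this approximation property. Since it determines `e`
  -- uniquely (`huniq`), linearity and agreement with `A` follow by exhibiting approximants, even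
  -- though `L` need not be injective.
  have hex : ∀ y, ∃ e, ∀ ε : ℝ, 0 < ε → ∃ c, p (y - L c) ≤ ε ∧ e - A c ∈ ε • D := by
    intro y
    choose c hcn using fun n : ℕ => hL y (1 / (n + 1)) Nat.one_div_pos_of_nat
    have hmem : ∀ k, A (c k) ∈ ⋃ n : ℕ, (n : ℝ) • D := fun k => by
      obtain ⟨n, hn⟩ := exists_nat_ge (p (L (c k)))
      refine mem_iUnion.2 ⟨n + 1, hA _ _ (by positivity) (hn.trans (by simp))⟩
    have hlim := tendsto_one_div_add_atTop_nhds_zero_nat (𝕜 := ℝ)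
    have hcauchy : ∀ k l, gauge D (A (c k) - A (c l)) ≤ 1 / ((k : ℝ) + 1) + 1 / ((l : ℝ) + 1) := by
      intro k l
      refine gauge_le_of_mem (by positivity) ?_
      rw [← map_sub]
      refine hA _ _ (by positivity) ?_
      rw [map_sub, show L (c k) - L (c l) = (y - L (c l)) - (y - L (c k)) by abel, add_comm]
      exact (map_sub_le_add p _ _).trans (add_le_add (hcn l) (hcn k))
    obtain ⟨z, hz, hzl⟩ := hE D hcl hbd hb hc (fun k => A (c k)) hmem (by
      intro r hr
      obtain ⟨N, hN⟩ := eventually_atTop.1 (hlim.eventually_lt_const (half_pos hr))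
      exact ⟨N, fun k hk l hl => (hcauchy k l).trans_lt (by linarith [hN k hk, hN l hl])⟩)
    refine ⟨z, fun ε hε => ?_⟩
    obtain ⟨k, hk1, hk2⟩ :=
      ((hlim.eventually_lt_const hε).and (hzl.eventually_lt_const hε)).exists
    refine ⟨c k, (hcn k).trans hk1.le, ?_⟩
    rw [← neg_sub]
    refine hneg (mem_smul_of_gauge_lt hc h0 ?_ hk2)
    obtain ⟨n, hn⟩ := mem_iUnion.1 (hmem k)
    obtain ⟨m, hm⟩ := mem_iUnion.1 hz
    refine mem_iUnion.2 ⟨n + m, ?_⟩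
    push_cast
    rw [sub_eq_add_neg]
    exact hadd n.cast_nonneg m.cast_nonneg hn (hneg hm)
  have huniq : ∀ y e e', (∀ ε : ℝ, 0 < ε → ∃ c, p (y - L c) ≤ ε ∧ e - A c ∈ ε • D) →
      (∀ ε : ℝ, 0 < ε → ∃ c, p (y - L c) ≤ ε ∧ e' - A c ∈ ε • D) → e = e' := by
    intro y e e' he he'
    refine sub_eq_zero.1 (eq_zero_of_forall_mem_smul hbd fun ε hε => ?_)
    -- `e - e'` splits into `e - A c`, `A (c - c')` and `A c' - e'`, costing ε/4, ε/2 and ε/4.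
    have h4 : 0 < ε / 4 := by positivity
    obtain ⟨c, h1, h2⟩ := he _ h4
    obtain ⟨c', h1', h2'⟩ := he' _ h4
    have h3 : A (c - c') ∈ (ε / 4 + ε / 4) • D := by
      refine hA _ _ (by positivity) ?_
      rw [map_sub, show L c - L c' = (y - L c') - (y - L c) by abel]
      exact (map_sub_le_add p _ _).trans (add_le_add h1' h1)
    have := hadd (by positivity) h4.le (hadd h4.le (by positivity) h2 h3) (hneg h2')
    rw [map_sub] at this
    rw [show ε / 4 + (ε / 4 + ε / 4) + ε / 4 = ε by ring] at this
    convert this using 1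
    abel
  choose u hu using hex
  refine ⟨{ toFun := u, map_add' := ?_, map_smul' := ?_ }, ?_, ?_⟩
  · intro y y'
    refine huniq _ _ _ (hu _) fun ε hε => ?_
    obtain ⟨c, h1, h2⟩ := hu y _ (half_pos hε)
    obtain ⟨c', h1', h2'⟩ := hu y' _ (half_pos hε)
    refine ⟨c + c', ?_, ?_⟩
    · rw [map_add, add_sub_add_comm]
      exact (map_add_le_add p _ _).trans (by linarith)
    · rw [map_add, add_sub_add_comm, ← add_halves ε]
      exact hadd (by positivity) (by positivity) h2 h2'
  · intro a y
    refine huniq _ _ _ (hu _) fun ε hε => ?_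
    have hpos : 0 < ‖a‖ + 1 := by positivity
    have hle : ‖a‖ * (ε / (‖a‖ + 1)) ≤ ε := by
      rw [mul_div_assoc', div_le_iff₀ hpos]
      nlinarith
    obtain ⟨c, h1, h2⟩ := hu y _ (div_pos hε hpos)
    refine ⟨a • c, ?_, ?_⟩
    · rw [map_smul, ← smul_sub, map_smul_eq_mul]
      exact (mul_le_mul_of_nonneg_left h1 (norm_nonneg a)).trans hle
    · rw [map_smul, RingHom.id_apply, ← smul_sub]
      exact hmono (by positivity) hle (hb.smul_mem_norm_smul hne h2 a)
  · intro c
    refine huniq _ _ _ (hu _) fun ε hε => ⟨c, by simpa using hε.le, ?_⟩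
    rw [sub_self]
    exact ⟨0, h0, smul_zero _⟩
  · intro y hy
    -- An approximant within 1 has `p (L c) ≤ 2`; the factor 3 is 1 + 2.
    obtain ⟨c, h1, h2⟩ := hu y 1 one_pos
    have h3 : A c ∈ (2 : ℝ) • D := by
      refine hA _ _ two_pos ?_
      rw [show L c = y - (y - L c) by abel]
      exact (map_sub_le_add p _ _).trans (by linarith)
    have := hadd zero_le_one zero_le_two h2 h3
    rw [sub_add_cancel] at this
    norm_num at this
    exact this

end LocallyComplete

/-! ### The polar of the unit ball of Fν(Ω). -/

section WeightedSpace

variable {𝕜 : Type*} [RCLike 𝕜] {Ω ω : Type*} {F : FunctionSpace 𝕜 Ω 𝕜}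
  {TK : F.Space →ₗ[𝕜] (ω → 𝕜)} {ν : ω → ℝ≥0}

/-- The inclusion `Fν(Ω) ⊆ F` is continuous if the unit ball of `Fν(Ω)` is compact in `F`. -/
noncomputable def WeightedSpace.inclCLM (hcompact : IsCompact (WeightedSpace.unitBall TK ν)) :
    WeightedSpace TK ν →L[𝕜] F.Space :=
  (WeightedSpace.incl TK ν).clmOfExistsBoundedImage
    ⟨_, Metric.closedBall_mem_nhds 0 one_pos, hcompact.isVonNBounded (𝕜 := 𝕜)⟩

/-- The restriction of functionals on `F` to `Fν(Ω)`. -/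
noncomputable def KappaDual.restrict (j : WeightedSpace TK ν →L[𝕜] F.Space) :
    KappaDual 𝕜 F.Space →ₗ[𝕜] WeightedSpace TK ν →L[𝕜] 𝕜 where
  toFun y' := ((UniformConvergenceCLM.ofFun (RingHom.id 𝕜) 𝕜 _).symm y').comp j
  map_add' _ _ := rfl
  map_smul' _ _ := rfl

theorem norm_restrict_le_one (hcompact : IsCompact (WeightedSpace.unitBall TK ν))
    {y' : KappaDual 𝕜 F.Space} (hy : y' ∈ WeightedSpace.unitBallPolar TK ν) :
    ‖KappaDual.restrict (WeightedSpace.inclCLM hcompact) y'‖ ≤ 1 :=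
  ContinuousLinearMap.opNorm_le_of_closedBall _ fun v hv =>
    hy _ ⟨v, by simpa using hv, rfl⟩

theorem norm_apply_mul_le_norm (g : WeightedSpace TK ν) (x : ω) :
    ‖TK (WeightedSpace.incl TK ν g) x‖ * (ν x : ℝ) ≤ ‖g‖ :=
  le_ciSup g.2 x

theorem smul_evalAt_mem_unitBallPolar (hT : ∀ x, Continuous fun f => TK f x) (x : ω) :
    ((ν x : ℝ) : 𝕜) • evalAt TK hT x ∈ WeightedSpace.unitBallPolar TK ν := by
  rintro _ ⟨g, hg, rfl⟩
  have h := (norm_apply_mul_le_norm g x).trans (by simpa using hg)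
  change ‖((ν x : ℝ) : 𝕜) • TK (WeightedSpace.incl TK ν g) x‖ ≤ 1
  rwa [norm_smul, RCLike.norm_of_nonneg (ν x).coe_nonneg, mul_comm]

/-- The ball is itself one of the absolutely convex compact sets defining κ. This turns boundedness
of `u` on B° into continuity on F(Ω)'_κ. -/
theorem unitBallPolar_mem_nhds_zero (hcompact : IsCompact (WeightedSpace.unitBall TK ν)) :
    WeightedSpace.unitBallPolar TK ν ∈ 𝓝 (0 : KappaDual 𝕜 F.Space) := by
  have hB : WeightedSpace.unitBall TK ν ∈
      {K : Set F.Space | Balanced 𝕜 K ∧ Convex ℝ K ∧ IsCompact K} := by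
    refine ⟨?_, ?_, hcompact⟩
    · rintro a ha _ ⟨_, ⟨g, hg, rfl⟩, rfl⟩
      refine ⟨a • g, ?_, map_smul _ _ _⟩
      simp only [Metric.mem_closedBall, dist_zero_right] at hg ⊢
      exact (norm_smul a g).trans_le (mul_le_one₀ ha (norm_nonneg g) hg)
    · rintro _ ⟨g, hg, rfl⟩ _ ⟨h, hh, rfl⟩ a b ha hb hab
      refine ⟨(a : 𝕜) • g + (b : 𝕜) • h, ?_, ?_⟩
      · simp only [Metric.mem_closedBall, dist_zero_right] at hg hh ⊢
        refine (norm_add_le _ _).trans ?_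
        rw [norm_smul, norm_smul, RCLike.norm_of_nonneg ha, RCLike.norm_of_nonneg hb, ← hab]
        exact add_le_add (mul_le_of_le_one_right ha hg) (mul_le_of_le_one_right hb hh)
      · simp only [RCLike.real_smul_eq_coe_smul (K := 𝕜), map_add, map_smul]
  filter_upwards [UniformConvergenceCLM.eventually_nhds_zero_mapsTo (RingHom.id 𝕜) hB
    (Metric.closedBall_mem_nhds (0 : 𝕜) one_pos)] with y' hy f hf
  simpa using hy hf

end WeightedSpace

/-! ### The restriction map: well-definedness and surjectivity. -/

theorem mapsTo_restrictionMap {𝕜 : Type*} [RCLike 𝕜] {Ω ω : Type*}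
    {E : Type*} [AddCommGroup E] [Module 𝕜 E] [Module ℝ E] [IsScalarTower ℝ 𝕜 E]
    [TopologicalSpace E] [IsTopologicalAddGroup E]
    (G : Submodule 𝕜 (E →L[𝕜] 𝕜)) {F : FunctionSpace 𝕜 Ω 𝕜} {FE : FunctionSpace 𝕜 Ω E}
    (hS : EpsIntoCompatible F FE) {TE : FE.Space →ₗ[𝕜] (ω → E)} {TK : F.Space →ₗ[𝕜] (ω → 𝕜)}
    (ν : ω → ℝ≥0) (hstrong : IsStrong TE TK) (hcons : IsConsistent hS.continuous_eval TE TK)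
    (U : Set ω) :
    MapsTo (restrictionMap TE U) (mingleMangle TK ν hS) (restrictionSpace TK ν G U) := by
  rintro _ ⟨u, hu, rfl⟩ e' -
  set f := FE.ofMem (mapS hS.continuous_eval u) (hS.mapS_mem u) with hf
  obtain ⟨hmem, hT⟩ := hstrong e' f
  obtain ⟨C, hC⟩ : ∃ C, ∀ y ∈ e' '' (u '' WeightedSpace.unitBallPolar TK ν), ‖y‖ ≤ C :=
    ((NormedSpace.isVonNBounded_iff 𝕜).1 (hu.image e')).exists_norm_le
  -- The function f_{e'} is e' ∘ f; its weighted values are |e'(u(ν(x)T_x))|, bounded by `C` because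
  -- ν(x)T_x lies in B°.
  refine ⟨⟨F.ofMem _ hmem, C, ?_⟩, fun x => hT x⟩
  rintro _ ⟨x, rfl⟩
  have h := hC _ ⟨_, ⟨_, smul_evalAt_mem_unitBallPolar hcons.continuous_apply x, rfl⟩, rfl⟩
  rw [map_smul, map_smul, norm_smul, RCLike.norm_of_nonneg (ν x).coe_nonneg, mul_comm] at h
  change ‖TK (F.ofMem _ hmem) x‖ * (ν x : ℝ) ≤ C
  rwa [hT, hf, hcons.apply_mapS]

theorem surjOn_restrictionMap {𝕜 : Type*} [RCLike 𝕜] {Ω ω : Type*}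
    {E : Type*} [AddCommGroup E] [Module 𝕜 E] [Module ℝ E] [IsScalarTower ℝ 𝕜 E]
    [TopologicalSpace E] [IsTopologicalAddGroup E] [ContinuousSMul 𝕜 E] [T2Space E]
    (hE : IsLocallyComplete 𝕜 E)
    {G : Submodule 𝕜 (E →L[𝕜] 𝕜)} (hG : DeterminesBoundedness G)
    {F : FunctionSpace 𝕜 Ω 𝕜} {FE : FunctionSpace 𝕜 Ω E}
    (hS : EpsIntoCompatible F FE) {TE : FE.Space →ₗ[𝕜] (ω → E)} {TK : F.Space →ₗ[𝕜] (ω → 𝕜)}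
    {ν : ω → ℝ≥0} (hcons : IsConsistent hS.continuous_eval TE TK)
    (hcompact : IsCompact (WeightedSpace.unitBall TK ν))
    {U : Set ω} (hU : IsUniquenessSet TK ν U) :
    SurjOn (restrictionMap TE U) (mingleMangle TK ν hS) (restrictionSpace TK ν G U) := by
  intro f hf
  have hT := hcons.continuous_apply
  let j := WeightedSpace.inclCLM hcompact
  let p : Seminorm 𝕜 (KappaDual 𝕜 F.Space) :=
    (normSeminorm 𝕜 (WeightedSpace TK ν →L[𝕜] 𝕜)).comp (KappaDual.restrict j)
  let t : U → F.Space →L[𝕜] 𝕜 := fun x => ⟨(LinearMap.proj (x : ω)).comp TK, hT x⟩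
  let L : (U →₀ 𝕜) →ₗ[𝕜] KappaDual 𝕜 F.Space :=
    Finsupp.linearCombination 𝕜 fun x : U => evalAt TK hT x
  let A : (U →₀ 𝕜) →ₗ[𝕜] E := Finsupp.linearCombination 𝕜 f
  have hL : ∀ y, ∀ ε : ℝ, 0 < ε → ∃ c, p (y - L c) ≤ ε := fun y ε hε =>
    exists_linearCombination_norm_sub_le j hcompact t (fun g hg => hU g fun x hx => hg ⟨x, hx⟩) y hε
  have hAL : ∀ (e' : E →L[𝕜] 𝕜) (g : WeightedSpace TK ν),
      (∀ x : U, TK (WeightedSpace.incl TK ν g) x = e' (f x)) →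
      ∀ c, e' (A c) = KappaDual.restrict j (L c) g := by
    intro e' g hg c
    have : (e' : E →ₗ[𝕜] 𝕜) ∘ₗ A =
        (ContinuousLinearMap.coeLM 𝕜 ∘ₗ KappaDual.restrict j ∘ₗ L).flip g := by
      ext x
      simpa [A, L] using! (hg x).symm
    exact congrArg (fun l : (U →₀ 𝕜) →ₗ[𝕜] 𝕜 => l c) this
  have : ContinuousConstSMul ℝ E :=
    ⟨fun r => by
      simpa only [RCLike.real_smul_eq_coe_smul (K := 𝕜)] using continuous_const_smul (r : 𝕜)⟩
  -- Boundedness is tested on `G` only, where `hAL` turns e' ∘ A into evaluation at f_{e'}.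
  have hbd : Bornology.IsVonNBounded 𝕜 (A '' (p.comp L).closedBall 0 1) := by
    refine isVonNBounded_of_forall_mem_exists_bound hG fun e' he' => ?_
    obtain ⟨g, hg⟩ := hf e' he'
    refine ⟨‖g‖, forall_mem_image.2 fun c hc => ?_⟩
    rw [hAL e' g hg]
    refine (ContinuousLinearMap.le_of_opNorm_le _ ?_ g).trans_eq (one_mul _)
    exact (Seminorm.mem_closedBall_zero _).1 hc
  have hb : Balanced 𝕜 (A '' (p.comp L).closedBall 0 1) := by
    rintro a ha _ ⟨_, ⟨c, hc, rfl⟩, rfl⟩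
    exact ⟨a • c, (Seminorm.balanced_closedBall_zero _ _).smul_mem ha hc, map_smul _ _ _⟩
  have hc : Convex ℝ (A '' (p.comp L).closedBall 0 1) :=
    ((p.comp L).convex_closedBall 0 1).linear_image (A.restrictScalars ℝ)
  obtain ⟨u, huL, hup⟩ := exists_linearMap_extension hE isClosed_closure hbd.closure hb.closure
    hc.closure p L A hL fun c h =>
      subset_closure ⟨c, (Seminorm.mem_closedBall_zero _).2 h, rfl⟩
  have hub : Bornology.IsVonNBounded 𝕜 (u '' WeightedSpace.unitBallPolar TK ν) := by
    have h3 : Bornology.IsVonNBounded 𝕜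
        ((3 : ℝ) • closure (A '' (p.comp L).closedBall 0 1)) := by
      refine (hbd.closure.image ((3 : 𝕜) • ContinuousLinearMap.id 𝕜 E)).subset ?_
      rintro _ ⟨e, he, rfl⟩
      refine ⟨e, he, ?_⟩
      change (3 : 𝕜) • e = (3 : ℝ) • e
      rw [RCLike.real_smul_eq_coe_smul (K := 𝕜), RCLike.ofReal_ofNat]
    exact h3.subset (image_subset_iff.2 fun y hy => hup y (norm_restrict_le_one hcompact hy))
  -- Scalar multiplication is κ-continuous because compact sets are bounded; a linear map bounded on
  -- a neighbourhood of 0 is then continuous.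
  have : ContinuousSMul 𝕜 (KappaDual 𝕜 F.Space) :=
    UniformConvergenceCLM.continuousSMul _ _ _ fun K hK => hK.2.2.isVonNBounded (𝕜 := 𝕜)
  let v : EpsProduct 𝕜 F.Space E := UniformConvergenceCLM.ofFun (RingHom.id 𝕜) E _
    (u.clmOfExistsBoundedImage ⟨_, unitBallPolar_mem_nhds_zero hcompact, hub⟩)
  refine ⟨_, ⟨v, hub, rfl⟩, funext fun x => (hcons.apply_mapS v x).trans ?_⟩
  simpa [L, A] using! huL (Finsupp.single x 1)

theorem mainTheorem1 {𝕜 : Type*} [RCLike 𝕜] {Ω ω : Type*} [Nonempty Ω] [Nonempty ω]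
    {E : Type*} [AddCommGroup E] [Module 𝕜 E] [Module ℝ E] [IsScalarTower ℝ 𝕜 E]
    [TopologicalSpace E] [IsTopologicalAddGroup E] [ContinuousSMul 𝕜 E]
    [LocallyConvexSpace ℝ E] [T2Space E] [Nontrivial E]
    (hE : IsLocallyComplete 𝕜 E)
    (G : Submodule 𝕜 (E →L[𝕜] 𝕜)) (hG : DeterminesBoundedness G)
    (F : FunctionSpace 𝕜 Ω 𝕜) (FE : FunctionSpace 𝕜 Ω E)
    (hS : EpsIntoCompatible F FE)
    (TE : FE.Space →ₗ[𝕜] (ω → E)) (TK : F.Space →ₗ[𝕜] (ω → 𝕜))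
    (ν : ω → ℝ≥0) (hν : ∀ x, 0 < ν x)
    (hstrong : IsStrong TE TK) (hcons : IsConsistent hS.continuous_eval TE TK)
    (hBanach : WeightedSpace.IsBanach TK ν)
    (hcompact : IsCompact (WeightedSpace.unitBall TK ν))
    (U : Set ω) (hU : IsUniquenessSet TK ν U) :
    ∃ hR : MapsTo (restrictionMap TE U) (mingleMangle TK ν hS) (restrictionSpace TK ν G U),
      Function.Surjective
        (hR.restrict (restrictionMap TE U) (mingleMangle TK ν hS) (restrictionSpace TK ν G U)) := by
  have hR := mapsTo_restrictionMap G hS ν hstrong hcons U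
  exact ⟨hR, hR.restrict_surjective_iff.2 (surjOn_restrictionMap hE hG hS hcons hcompact hU)⟩
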